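/- Let $p$ be a prime, let $\mathbf{C}_p$ be the completion of an algebraic closure of $\mathbf{Q}_p$, let $\overline{\mathbf{Q}}\subset\mathbf{C}_p$ be the subfield of algebraic numbers, let $\log_p\colon \mathbf{C}_p^*\to\mathbf{C}_p$ be Iwasawa's $p$-adic logarithm (the homomorphism given by $\log_p(1+x)=\sum_{k\ge 1}(-1)^{k-1}x^k/k$ for $|x|<1$, with $\log_p(p)=0$), and put $\mathscr{L}_p=\{\log_p(x) : x\in\overline{\mathbf{Q}}^*\}$. Suppose that the $p$-adic Matrix Coefficient Conjecture holds for $p$: for every $n$ and every $M\in M_{n\times n}(\mathscr{L}_p)$ with $\det(M)=0$ there exist nonzero vectors $w,v\in\mathbf{Q}^n$ with $\langle w,Mv\rangle=0$, where $\langle\ ,\ \rangle$ is the dot product. Then Leopoldt's conjecture holds for $p$ and every number field $F$: with $U=\mathcal{O}_F^*\otimes_{\mathbf{Z}}\mathbf{Q}$, the image of the $\mathbf{C}_p$-linear map $$\mathrm{reg}_p\colon U\otimes_{\mathbf{Q}}\mathbf{C}_p\longrightarrow\bigoplus_{\tau\colon F\hookrightarrow\mathbf{C}_p}\mathbf{C}_p,\qquad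 u\mapsto(\log_p\tau(u))_\tau,$$ where $\tau$ runs over all embeddings of $F$ into $\mathbf{C}_p$, has dimension $r=r_1+r_2-1$, where $r_1$ and $r_2$ are the numbers of real and complex places of $F$ (so $r=\dim_{\mathbf{Q}}U$). -/

import Mathlib

section PadicLogarithm

open Filter Topology

/-- The power series of `log (1 + x)`, namely `x - x ^ 2 / 2 + x ^ 3 / 3 - ...`, summed in `ℂ_[p]`;
it converges for `‖x‖ < 1`. -/
noncomputable def padicLogSeries (p : ℕ) [Fact p.Prime] (x : ℂ_[p]) : ℂ_[p] :=
  ∑' n : ℕ, (-1) ^ n * x ^ (n + 1) / ((n : ℂ_[p]) + 1)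

theorem PadicComplex.norm_natCast_le_one (p : ℕ) [Fact p.Prime] (n : ℕ) :
    ‖(n : ℂ_[p])‖ ≤ 1 := IsUltrametricDist.norm_natCast_le_one _ n

theorem PadicComplex.norm_p (p : ℕ) [Fact p.Prime] : ‖(p : ℂ_[p])‖ = (p : ℝ)⁻¹ := by
  have h := PadicComplex.norm_extends' p (p : ℚ_[p])
  rw [Padic.norm_p] at h
  rw [← h]
  simp

theorem PadicComplex.inv_norm_succ_le (p : ℕ) [Fact p.Prime] (n : ℕ) :
    ‖(n : ℂ_[p]) + 1‖⁻¹ ≤ (n : ℝ) + 1 := by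
  have h : ‖(n : ℂ_[p]) + 1‖ = ‖((n + 1 : ℕ) : ℚ_[p])‖ := by
    rw [← norm_algebraMap' ℂ_[p] ((n + 1 : ℕ) : ℚ_[p]), map_natCast]; simp
  have h0 : ((n + 1 : ℕ) : ℚ_[p]) ≠ 0 := by exact_mod_cast n.succ_ne_zero
  rw [h, Padic.norm_eq_zpow_neg_valuation h0, Padic.valuation_natCast, zpow_neg, inv_inv,
    zpow_natCast]
  exact_mod_cast Nat.le_of_dvd n.succ_pos pow_padicValNat_dvd

theorem tendsto_prime_pow_zero (p : ℕ) [Fact p.Prime] :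
    Tendsto (fun n : ℕ => (p : ℂ_[p]) ^ n) atTop (𝓝 0) := by
  apply tendsto_pow_atTop_nhds_zero_of_norm_lt_one
  rw [PadicComplex.norm_p]
  exact inv_lt_one_of_one_lt₀ (by exact_mod_cast (Fact.out : p.Prime).one_lt)

theorem choose_succ_cast (p : ℕ) [Fact p.Prime] (N k : ℕ) :
    (((N + 1).choose (k + 1) : ℕ) : ℂ_[p])
      = ((N + 1 : ℕ) : ℂ_[p]) * ((N.choose k : ℕ) / ((k : ℂ_[p]) + 1)) := by
  have h : ((k : ℂ_[p]) + 1) ≠ 0 := by exact_mod_cast k.succ_ne_zero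
  rw [← mul_div_assoc, eq_div_iff h]
  exact_mod_cast (Nat.add_one_mul_choose_eq N k).symm

theorem tendsto_choose_prime_pow (p : ℕ) [Fact p.Prime] (k : ℕ) :
    Tendsto (fun n : ℕ => (((p ^ n - 1).choose k : ℕ) : ℂ_[p])) atTop (𝓝 ((-1) ^ k)) := by
  induction k with
  | zero => simp
  | succ k ih =>
    have h1 : ∀ n : ℕ, p ^ n - 1 + 1 = p ^ n := fun n =>
      Nat.sub_add_cancel (Nat.one_le_pow _ _ (Fact.out : p.Prime).pos)
    have h2 : ∀ n : ℕ, (((p ^ n - 1).choose (k + 1) : ℕ) : ℂ_[p])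
        = (p : ℂ_[p]) ^ n * ((((p ^ n - 1).choose k : ℕ) : ℂ_[p]) / ((k : ℂ_[p]) + 1))
          - (((p ^ n - 1).choose k : ℕ) : ℂ_[p]) := by
      intro n
      have := choose_succ_cast p (p ^ n - 1) k
      rw [Nat.choose_succ_succ', h1] at this
      push_cast at this
      rw [← this]; ring
    simp_rw [h2]
    have := ((tendsto_prime_pow_zero p).mul (ih.div_const ((k : ℂ_[p]) + 1))).sub ih
    simpa [pow_succ] using this

theorem tendsto_padicLogSeries (p : ℕ) [Fact p.Prime] {x : ℂ_[p]} (hx : ‖x‖ < 1) :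
    Tendsto (fun n : ℕ => ((1 + x) ^ (p ^ n) - 1) / (p : ℂ_[p]) ^ n) atTop
      (𝓝 (padicLogSeries p x)) := by
  have hp0 : (p : ℂ_[p]) ≠ 0 := by exact_mod_cast (Fact.out : p.Prime).ne_zero
  have key : ∀ n : ℕ, ((1 + x) ^ (p ^ n) - 1) / (p : ℂ_[p]) ^ n
      = ∑' k : ℕ, (((p ^ n - 1).choose k : ℕ) : ℂ_[p]) * x ^ (k + 1) / ((k : ℂ_[p]) + 1) := by
    intro n
    obtain ⟨N, hN⟩ : ∃ N, p ^ n = N + 1 :=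
      Nat.exists_eq_succ_of_ne_zero (pow_ne_zero _ (Fact.out : p.Prime).ne_zero)
    have hN' : (p : ℂ_[p]) ^ n = ((N + 1 : ℕ) : ℂ_[p]) := by exact_mod_cast hN
    have hN0 : ((N + 1 : ℕ) : ℂ_[p]) ≠ 0 := by exact_mod_cast N.succ_ne_zero
    rw [tsum_eq_sum (s := Finset.range (N + 1)), hN', hN, add_comm 1 x, add_pow,
      Finset.sum_range_succ', div_eq_iff hN0]
    · simp only [choose_succ_cast, one_pow, mul_one, pow_zero, Nat.choose_zero_right, Nat.cast_one,
        add_sub_cancel_right, Finset.sum_mul, Nat.add_sub_cancel]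
      refine Finset.sum_congr rfl fun k _ => ?_
      ring
    · intro k hk
      rw [Finset.mem_range, not_lt] at hk
      rw [hN, Nat.choose_eq_zero_of_lt (by omega)]
      simp
  simp_rw [key]
  refine tendsto_tsum_of_dominated_convergence
    (bound := fun k : ℕ => ((k : ℝ) + 1) * ‖x‖ ^ (k + 1)) ?_ ?_ ?_
  · have := (summable_pow_mul_geometric_of_norm_lt_one 1 (r := ‖x‖) (by simpa using hx))
    have h := (summable_nat_add_iff 1).2 this
    simpa using h
  · intro k
    exact ((tendsto_choose_prime_pow p k).mul_const _).div_const _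
  · refine Eventually.of_forall fun n k => ?_
    rw [norm_div, norm_mul, norm_pow, div_eq_mul_inv, mul_comm]
    refine mul_le_mul (PadicComplex.inv_norm_succ_le p k) ?_ (by positivity) (by positivity)
    exact mul_le_of_le_one_left (by positivity) (PadicComplex.norm_natCast_le_one p _)

theorem norm_mul_sub_one_lt (p : ℕ) [Fact p.Prime] {u v : ℂ_[p]} (hu : ‖u - 1‖ < 1)
    (hv : ‖v - 1‖ < 1) : ‖u * v - 1‖ < 1 := by
  have h : u * v - 1 = (u - 1) * (v - 1) + ((u - 1) + (v - 1)) := by ring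
  rw [h]
  refine (PadicComplex.isNonarchimedean p _ _).trans_lt (max_lt ?_ ?_)
  · rw [norm_mul]; exact mul_lt_one_of_nonneg_of_lt_one_left (norm_nonneg _) hu hv.le
  · exact (PadicComplex.isNonarchimedean p _ _).trans_lt (max_lt hu hv)

theorem norm_pow_sub_one_lt (p : ℕ) [Fact p.Prime] {u : ℂ_[p]} (hu : ‖u - 1‖ < 1) (k : ℕ) :
    ‖u ^ k - 1‖ < 1 := by
  induction k with
  | zero => simp
  | succ k ih => rw [pow_succ]; exact norm_mul_sub_one_lt p ih hu

theorem padicLogSeries_mul (p : ℕ) [Fact p.Prime] {u v : ℂ_[p]} (hu : ‖u - 1‖ < 1)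
    (hv : ‖v - 1‖ < 1) :
    padicLogSeries p (u * v - 1) = padicLogSeries p (u - 1) + padicLogSeries p (v - 1) := by
  have hp0 : (p : ℂ_[p]) ≠ 0 := by exact_mod_cast (Fact.out : p.Prime).ne_zero
  have h1 := tendsto_padicLogSeries p hu
  have h2 := tendsto_padicLogSeries p hv
  have h3 := tendsto_padicLogSeries p (norm_mul_sub_one_lt p hu hv)
  have h4 := (h1.add h2).add ((tendsto_prime_pow_zero p).mul (h1.mul h2))
  rw [zero_mul, add_zero] at h4
  refine tendsto_nhds_unique h3 (h4.congr fun n => ?_)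
  have : (p : ℂ_[p]) ^ n ≠ 0 := pow_ne_zero _ hp0
  simp only [add_sub_cancel, mul_pow]
  field_simp
  ring

theorem padicLogSeries_pow (p : ℕ) [Fact p.Prime] {u : ℂ_[p]} (hu : ‖u - 1‖ < 1) (k : ℕ) :
    padicLogSeries p (u ^ k - 1) = k * padicLogSeries p (u - 1) := by
  induction k with
  | zero => simp [padicLogSeries]
  | succ k ih =>
    rw [pow_succ, padicLogSeries_mul p (norm_pow_sub_one_lt p hu k) hu, ih]
    push_cast; ring

theorem PadicComplex.exists_pow_near_one_of_norm_one (p : ℕ) [Fact p.Prime] {y : PadicAlgCl p}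
    (hy : ‖y‖ = 1) : ∃ k : ℕ, 0 < k ∧ ‖y ^ k - 1‖ < 1 := by
  have hyi : IsIntegral ℚ_[p] y := (Algebra.IsAlgebraic.isAlgebraic y).isIntegral
  have hmon := minpoly.monic hyi
  have hcoeff : ∀ n, ‖(minpoly ℚ_[p] y).coeff n‖ ≤ 1 := by
    rw [← spectralValue_le_one_iff hmon]
    exact hy.le
  have hlift : minpoly ℚ_[p] y ∈ Polynomial.lifts (algebraMap ℤ_[p] ℚ_[p]) := by
    rw [Polynomial.lifts_iff_coeff_lifts]
    exact fun n => ⟨⟨_, hcoeff n⟩, rfl⟩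
  obtain ⟨f, hf, -, hfm⟩ := Polynomial.lifts_and_natDegree_eq_and_monic hlift hmon
  have hroot : Polynomial.aeval y f = 0 := by
    rw [← Polynomial.aeval_map_algebraMap ℚ_[p], hf, minpoly.aeval]
  have hrep : ∀ n : ℕ, y ^ n = ∑ i : Fin f.natDegree,
      algebraMap ℤ_[p] (PadicAlgCl p) ((Polynomial.X ^ n %ₘ f).coeff i) * y ^ (i : ℕ) := by
    intro n
    have h1 : Polynomial.aeval y (Polynomial.X ^ n %ₘ f : Polynomial ℤ_[p]) = y ^ n := by
      rw [Polynomial.modByMonic_eq_sub_mul_div, map_sub, map_mul, hroot]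
      simp
    by_cases hd : f.natDegree = 0
    · rw [Polynomial.natDegree_eq_zero] at hd
      obtain ⟨c, rfl⟩ := hd
      have : c = 1 := by simpa [Polynomial.Monic] using hfm
      subst this
      simp at hroot
    have hlt : (Polynomial.X ^ n %ₘ f).natDegree < f.natDegree :=
      Polynomial.natDegree_modByMonic_lt _ hfm (by rintro rfl; simp at hd)
    rw [← h1, Polynomial.aeval_eq_sum_range' hlt, Finset.sum_range]
    simp [Algebra.smul_def]
  obtain ⟨i, j, hij, hne⟩ : ∃ i j : ℕ, (fun a : Fin f.natDegree =>
      PadicInt.toZMod ((Polynomial.X ^ i %ₘ f).coeff a)) = (fun a : Fin f.natDegree =>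
      PadicInt.toZMod ((Polynomial.X ^ j %ₘ f).coeff a)) ∧ i < j := by
    obtain ⟨i, j, hne, h⟩ := Finite.exists_ne_map_eq_of_infinite (fun n : ℕ =>
      (fun a : Fin f.natDegree => PadicInt.toZMod ((Polynomial.X ^ n %ₘ f).coeff (a : ℕ))))
    rcases lt_or_gt_of_ne hne with h' | h'
    · exact ⟨i, j, h, h'⟩
    · exact ⟨j, i, h.symm, h'⟩
  refine ⟨j - i, by omega, ?_⟩
  have hsub : y ^ j - y ^ i = y ^ i * (y ^ (j - i) - 1) := by
    rw [mul_sub, ← pow_add, mul_one]; congr 2; omega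
  have hnorm : ‖y ^ (j - i) - 1‖ = ‖y ^ j - y ^ i‖ := by
    rw [hsub, norm_mul, norm_pow, hy, one_pow, one_mul]
  rw [hnorm, hrep j, hrep i, ← Finset.sum_sub_distrib]
  refine Finset.sum_induction _ (fun x : PadicAlgCl p => ‖x‖ < 1)
    (fun a b ha hb => (PadicAlgCl.isNonarchimedean p a b).trans_lt (max_lt ha hb)) (by simp) ?_
  intro a _
  have hmem : (Polynomial.X ^ j %ₘ f).coeff a - (Polynomial.X ^ i %ₘ f).coeff a ∈
      RingHom.ker (PadicInt.toZMod (p := p)) := by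
    rw [RingHom.mem_ker, map_sub, sub_eq_zero]
    exact (congrFun hij a).symm
  rw [PadicInt.ker_toZMod, IsLocalRing.mem_maximalIdeal, PadicInt.mem_nonunits] at hmem
  rw [← sub_mul, ← map_sub, norm_mul, norm_pow, hy, one_pow, mul_one,
    IsScalarTower.algebraMap_apply ℤ_[p] ℚ_[p] (PadicAlgCl p), norm_algebraMap']
  exact hmem

/-- Every nonzero `z` in `ℂ_[p]` has a positive power `z ^ k` which, up to an integral power of `p`,
is of the form `1 + x` with `‖x‖ < 1`. -/
theorem PadicComplex.exists_normalization (p : ℕ) [Fact p.Prime] {z : ℂ_[p]} (hz : z ≠ 0) :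
    ∃ km : ℕ × ℤ, 0 < km.1 ∧ ‖z ^ km.1 * (p : ℂ_[p]) ^ km.2 - 1‖ < 1 := by
  have hp0 : (p : ℂ_[p]) ≠ 0 := by exact_mod_cast (Fact.out : p.Prime).ne_zero
  obtain ⟨a, ha⟩ : ∃ a : PadicAlgCl p, ‖z - (a : ℂ_[p])‖ < ‖z‖ := by
    obtain ⟨a, ha⟩ := UniformSpace.Completion.denseRange_coe.exists_dist_lt z (norm_pos_iff.2 hz)
    exact ⟨a, by rwa [dist_eq_norm] at ha⟩
  have ha0 : (a : ℂ_[p]) ≠ 0 := by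
    intro h; rw [h, sub_zero] at ha; exact lt_irrefl _ ha
  have ha0' : a ≠ 0 := by rintro rfl; exact ha0 rfl
  have haz : ‖(a : ℂ_[p])‖ = ‖z‖ := by
    have h : ‖z + -(a : ℂ_[p])‖ < max ‖z‖ ‖-(a : ℂ_[p])‖ := by
      rw [← sub_eq_add_neg]; exact lt_max_of_lt_left ha
    rw [IsUltrametricDist.norm_eq_of_add_norm_lt_max h, norm_neg]
  have hza : ‖z / a - 1‖ < 1 := by
    rw [div_sub_one ha0, norm_div, haz]
    exact (div_lt_one (norm_pos_iff.2 hz)).2 ha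
  have hai : IsIntegral ℚ_[p] a := (Algebra.IsAlgebraic.isAlgebraic a).isIntegral
  set d := (minpoly ℚ_[p] a).natDegree with hd
  have hd0 : 0 < d := minpoly.natDegree_pos hai
  have hc0 : (minpoly ℚ_[p] a).coeff 0 ≠ 0 := minpoly.coeff_zero_ne_zero hai ha0'
  have hnorm : ‖a‖ ^ d = ‖(minpoly ℚ_[p] a).coeff 0‖ := by
    rw [← PadicAlgCl.spectralNorm_eq, spectralNorm.spectralNorm_eq_norm_coeff_zero_rpow, ← hd,
      ← Real.rpow_natCast, ← Real.rpow_mul (norm_nonneg _), one_div_mul_cancel (by positivity),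
      Real.rpow_one]
  rw [Padic.norm_eq_zpow_neg_valuation hc0] at hnorm
  set v := ((minpoly ℚ_[p] a).coeff 0).valuation
  have hpn : ‖(p : PadicAlgCl p)‖ = (p : ℝ)⁻¹ := by
    rw [← PadicComplex.norm_p p, ← PadicComplex.norm_extends p, PadicComplex.coe_natCast]
  have hy : ‖a ^ d * (p : PadicAlgCl p) ^ (-v)‖ = 1 := by
    rw [norm_mul, norm_pow, hnorm, norm_zpow, hpn, inv_zpow, ← zpow_neg, neg_neg,
      ← zpow_add₀ (by exact_mod_cast (Fact.out : p.Prime).ne_zero)]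
    simp
  obtain ⟨k, hk, hlt⟩ := PadicComplex.exists_pow_near_one_of_norm_one p hy
  refine ⟨(d * k, -v * k), Nat.mul_pos hd0 hk, ?_⟩
  have hlt' : ‖((a : ℂ_[p]) ^ d * (p : ℂ_[p]) ^ (-v)) ^ k - 1‖ < 1 := by
    rw [← PadicComplex.norm_extends p] at hlt
    convert hlt using 2
    simp only [PadicComplex.coe_eq, map_sub, map_pow, map_mul, map_one, map_zpow₀, map_natCast]
  have := norm_mul_sub_one_lt p (norm_pow_sub_one_lt p hza (d * k)) hlt'
  convert this using 2
  simp only [mul_pow, div_pow, zpow_mul, zpow_natCast, pow_mul]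
  field_simp

open Classical in
/-- Iwasawa's `p`-adic logarithm on nonzero elements of `ℂ_[p]` (with junk value `0` at `0`): if
`z ^ k * p ^ m = 1 + x` with `k > 0` and `‖x‖ < 1`, then `log z = log (1 + x) / k`.
Such `k, m` exist for every `z ≠ 0` (`PadicComplex.exists_normalization`), and the value does not
depend on their choice (`iwasawaLog_eq`). It is the homomorphism (`iwasawaLog_mul`) that is given by
the logarithm series near `1` (`iwasawaLog_one_add`) and kills `p` (`iwasawaLog_p`). -/
noncomputable def iwasawaLog (p : ℕ) [Fact p.Prime] (z : ℂ_[p]) : ℂ_[p] :=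
  if h : ∃ km : ℕ × ℤ, 0 < km.1 ∧ ‖z ^ km.1 * (p : ℂ_[p]) ^ km.2 - 1‖ < 1 then
    padicLogSeries p (z ^ h.choose.1 * (p : ℂ_[p]) ^ h.choose.2 - 1) / (h.choose.1 : ℂ_[p])
  else 0

theorem iwasawaLog_eq (p : ℕ) [Fact p.Prime] {z : ℂ_[p]} {k : ℕ} {m : ℤ} (hk : 0 < k)
    (hm : ‖z ^ k * (p : ℂ_[p]) ^ m - 1‖ < 1) :
    iwasawaLog p z = padicLogSeries p (z ^ k * (p : ℂ_[p]) ^ m - 1) / (k : ℂ_[p]) := by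
  have h : ∃ km : ℕ × ℤ, 0 < km.1 ∧ ‖z ^ km.1 * (p : ℂ_[p]) ^ km.2 - 1‖ < 1 := ⟨(k, m), hk, hm⟩
  rw [iwasawaLog, dif_pos h]
  obtain ⟨hk', hm'⟩ := h.choose_spec
  set k' := h.choose.1
  set m' := h.choose.2
  have hz : z ≠ 0 := by
    rintro rfl
    simp [zero_pow hk.ne'] at hm
  have hp0 : (p : ℂ_[p]) ≠ 0 := by exact_mod_cast (Fact.out : p.Prime).ne_zero
  have hone : ∀ {u : ℂ_[p]}, ‖u - 1‖ < 1 → ‖u‖ = 1 := by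
    intro u hu
    have h : ‖u + -1‖ < max ‖u‖ ‖(-1 : ℂ_[p])‖ := by
      rw [← sub_eq_add_neg, norm_neg, norm_one]; exact lt_max_of_lt_right hu
    rw [IsUltrametricDist.norm_eq_of_add_norm_lt_max h, norm_neg, norm_one]
  have hmm : m' * k = m * k' := by
    have e : (z ^ k' * (p : ℂ_[p]) ^ m') ^ k = (z ^ k * (p : ℂ_[p]) ^ m) ^ k' *
        (p : ℂ_[p]) ^ (m' * k - m * k') := by
      rw [zpow_sub₀ hp0, zpow_mul, zpow_mul, zpow_natCast, zpow_natCast, mul_pow, mul_pow,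
        ← pow_mul, ← pow_mul, mul_comm k k']
      field_simp
    have e' := congrArg norm e
    rw [norm_mul, norm_pow, norm_pow, hone hm, hone hm', one_pow, one_pow, one_mul, norm_zpow,
      PadicComplex.norm_p] at e'
    have hp1 : (p : ℝ)⁻¹ ≠ 1 := by
      rw [ne_eq, inv_eq_one]; exact_mod_cast (Fact.out : p.Prime).one_lt.ne'
    have := (zpow_eq_one_iff_right₀ (by positivity) hp1).1 e'.symm
    omega
  have e : (z ^ k' * (p : ℂ_[p]) ^ m') ^ k = (z ^ k * (p : ℂ_[p]) ^ m) ^ k' := by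
    rw [mul_pow, mul_pow, ← pow_mul, ← pow_mul, ← zpow_natCast (_ ^ m'), ← zpow_mul,
      ← zpow_natCast (_ ^ m), ← zpow_mul, hmm, mul_comm k k']
  have h1 := padicLogSeries_pow p hm' k
  rw [e, padicLogSeries_pow p hm k'] at h1
  have hk0 : (k : ℂ_[p]) ≠ 0 := by exact_mod_cast hk.ne'
  have hk0' : (k' : ℂ_[p]) ≠ 0 := by exact_mod_cast hk'.ne'
  rw [div_eq_div_iff hk0' hk0, mul_comm, ← h1, mul_comm]

theorem iwasawaLog_one_add (p : ℕ) [Fact p.Prime] {x : ℂ_[p]} (hx : ‖x‖ < 1) :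
    iwasawaLog p (1 + x) = padicLogSeries p x := by
  rw [iwasawaLog_eq p (k := 1) (m := 0) one_pos (by simpa using hx)]
  simp

theorem iwasawaLog_p (p : ℕ) [Fact p.Prime] : iwasawaLog p (p : ℂ_[p]) = 0 := by
  have hp0 : (p : ℂ_[p]) ≠ 0 := by exact_mod_cast (Fact.out : p.Prime).ne_zero
  have h : (p : ℂ_[p]) ^ 1 * (p : ℂ_[p]) ^ (-1 : ℤ) - 1 = 0 := by simp [hp0]
  rw [iwasawaLog_eq p (k := 1) (m := -1) one_pos (by rw [h]; simp), h]
  simp [padicLogSeries]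

theorem iwasawaLog_mul (p : ℕ) [Fact p.Prime] {y z : ℂ_[p]} (hy : y ≠ 0) (hz : z ≠ 0) :
    iwasawaLog p (y * z) = iwasawaLog p y + iwasawaLog p z := by
  obtain ⟨⟨k, m⟩, hk, hm⟩ := PadicComplex.exists_normalization p hy
  obtain ⟨⟨k', m'⟩, hk', hm'⟩ := PadicComplex.exists_normalization p hz
  dsimp only at hk hm hk' hm'
  have hp0 : (p : ℂ_[p]) ≠ 0 := by exact_mod_cast (Fact.out : p.Prime).ne_zero
  have e : (y * z) ^ (k * k') * (p : ℂ_[p]) ^ (m * k' + m' * k)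
      = (y ^ k * (p : ℂ_[p]) ^ m) ^ k' * (z ^ k' * (p : ℂ_[p]) ^ m') ^ k := by
    rw [zpow_add₀ hp0, zpow_mul, zpow_mul, zpow_natCast, zpow_natCast]
    ring
  have h1 := norm_pow_sub_one_lt p hm k'
  have h2 := norm_pow_sub_one_lt p hm' k
  have h3 := norm_mul_sub_one_lt p h1 h2
  have hk0 : (k : ℂ_[p]) ≠ 0 := by exact_mod_cast hk.ne'
  have hk0' : (k' : ℂ_[p]) ≠ 0 := by exact_mod_cast hk'.ne'
  rw [iwasawaLog_eq p hk hm, iwasawaLog_eq p hk' hm',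
    iwasawaLog_eq p (Nat.mul_pos hk hk') (m := m * k' + m' * k) (by rwa [e]), e,
    padicLogSeries_mul p h1 h2, padicLogSeries_pow p hm, padicLogSeries_pow p hm']
  push_cast
  field_simp

end PadicLogarithm

section Conjectures

open scoped TensorProduct NumberField

/-- The set `𝓛_p` of `p`-adic logarithms of nonzero algebraic numbers. -/
def logsOfAlgebraicNumbers (p : ℕ) [Fact p.Prime] : Set ℂ_[p] :=
  {l | ∃ x : ℂ_[p], x ≠ 0 ∧ IsAlgebraic ℚ x ∧ iwasawaLog p x = l}

/-- The `p`-adic Matrix Coefficient Conjecture: for every singular square matrix `M` with entries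
in `𝓛_p` there are nonzero rational vectors `w, v` with `⟨w, M v⟩ = 0`. -/
def PadicMatrixCoefficientConjecture (p : ℕ) [Fact p.Prime] : Prop :=
  ∀ (n : ℕ) (M : Matrix (Fin n) (Fin n) ℂ_[p]),
    (∀ i j, M i j ∈ logsOfAlgebraicNumbers p) → M.det = 0 →
    ∃ w v : Fin n → ℚ, w ≠ 0 ∧ v ≠ 0 ∧
      (fun i => (w i : ℂ_[p])) ⬝ᵥ M.mulVec (fun j => (v j : ℂ_[p])) = 0

/-- The homomorphism `u ↦ (log_p (τ u))_τ` on the units of `𝓞 F`, where `τ` runs over all embeddings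
of `F` into `ℂ_[p]`. -/
noncomputable def unitLogHom (p : ℕ) [Fact p.Prime] (F : Type*) [Field F] :
    Additive (𝓞 F)ˣ →+ ((F →+* ℂ_[p]) → ℂ_[p]) where
  toFun u τ := iwasawaLog p (τ ((Additive.toMul u : (𝓞 F)ˣ) : F))
  map_zero' := by
    funext τ
    have h := iwasawaLog_mul p (one_ne_zero (α := ℂ_[p])) one_ne_zero
    simpa using h
  map_add' u v := by
    funext τ
    have h : ∀ w : (𝓞 F)ˣ, τ ((w : 𝓞 F) : F) ≠ 0 := fun w => by simp
    simpa using iwasawaLog_mul p (h u.toMul) (h v.toMul)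

/-- The `p`-adic regulator map: the `ℂ_[p]`-linear extension of `u ↦ (log_p (τ u))_τ` to
`U ⊗ ℂ_[p]`, where `U = (𝓞 F)ˣ ⊗ ℚ`. -/
noncomputable def padicRegulatorMap (p : ℕ) [Fact p.Prime] (F : Type*) [Field F] :
    ℂ_[p] ⊗[ℚ] (ℚ ⊗[ℤ] Additive (𝓞 F)ˣ) →ₗ[ℂ_[p]] ((F →+* ℂ_[p]) → ℂ_[p]) :=
  ((unitLogHom p F).toIntLinearMap.liftBaseChange ℚ).liftBaseChange ℂ_[p]

/-- Leopoldt's conjecture for `F` and `p`: the image of the `p`-adic regulator map has dimension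
`r = r₁ + r₂ - 1`, the rank of the unit group of `F`. -/
def LeopoldtConjecture (p : ℕ) [Fact p.Prime] (F : Type*) [Field F] [NumberField F] : Prop :=
  Module.finrank ℂ_[p] (LinearMap.range (padicRegulatorMap p F)) = NumberField.Units.rank F

end Conjectures

/-!
The regulator is injective for `F` as soon as it is injective for a larger number field, since
embeddings into `ℂ_[p]` of the larger field restrict to `F`
(`padicRegulatorMap_injective_of_ringHom`). So let `E` be normal over `ℚ` with Galois group `G`,
put `A = ℚ[G]` and `U = 𝓞ˣ ⊗ ℚ`, fix one embedding `τ` of `E` into `ℂ_[p]`, and let `ℓ : U → ℂ_[p]`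
be `log_p ∘ τ`. Each `τ ∘ g` with `g ∈ G` is again an embedding, so a vector `x` of `ℂ_[p] ⊗ U` in
the kernel of the regulator satisfies `ℓ (a x) = 0` for all `a ∈ A`.

If `x ≠ 0`, semisimplicity of `A` gives a minimal left ideal `I = A e`, with `e` idempotent, such
that `e x ≠ 0`. Acting on a nonzero vector of `e U` is injective on `I`, so the pairing `I × e U →
U`, `(w, v) ↦ w v` has no zero divisors. If `w₁, …, wₘ ∈ I` are independent and `v₁, …, vₘ` is a
basis of `e U`, the matrix `(ℓ (wᵢ vⱼ))` is killed by the coordinates of `e x`, hence singular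
(`exists_singular_matrix_of_forall_baseChange_eq_zero`). The Matrix Coefficient Conjecture now
gives nonzero `w ∈ I` and `v ∈ e U` with `ℓ (w v) = 0`. But `ℓ` is injective on `U`
(`unitLog_injective`), as the logarithm of an algebraic unit vanishes only at roots of unity; thus
`w v = 0`, a contradiction.

That there are enough independent `wᵢ`, i.e. `dim e U ≤ dim A e`, comes from Dirichlet's unit
theorem: the logarithms of the archimedean absolute values embed `U ⊗ ℝ` equivariantly into the
regular representation `G → ℝ` (`injective_liftBaseChange_galLog`). There `e` acts by a matrix with
rational entries whose columns span a space containing the image of `e U` and whose rows span `A e`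
(`finrank_range_asAlgebraHom_le`).
-/

/-! ### The kernel of the `p`-adic logarithm -/

section PadicLogarithmKernel

open Filter Topology

theorem norm_one_add_pow_prime_sub_one (p : ℕ) [Fact p.Prime] {x : ℂ_[p]}
    (hx : ‖x‖ < (p : ℝ)⁻¹) : ‖(1 + x) ^ p - 1‖ = (p : ℝ)⁻¹ * ‖x‖ := by
  have hp := (Fact.out : p.Prime)
  rcases eq_or_ne x 0 with rfl | hx0
  · simp
  have hx1 : ‖x‖ < 1 := hx.trans (inv_lt_one_of_one_lt₀ (by exact_mod_cast hp.one_lt))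
  have hpos : 0 < ‖x‖ := norm_pos_iff.2 hx0
  obtain ⟨c, hc, hc1⟩ : ∃ c : ℂ_[p], (1 + x) ^ p - 1 = p * x + x ^ 2 * c ∧ ‖c‖ ≤ 1 := by
    refine ⟨∑ i ∈ Finset.range (p - 1), x ^ i * (p.choose (i + 2) : ℕ), ?_, ?_⟩
    · have h2 : p + 1 = p - 1 + 1 + 1 := by have := hp.two_le; omega
      rw [add_comm 1 x, add_pow, h2, Finset.sum_range_succ', Finset.sum_range_succ',
        Finset.mul_sum]
      simp only [one_pow, mul_one, pow_zero, Nat.choose_zero_right, Nat.cast_one, zero_add,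
        pow_one, Nat.choose_one_right]
      rw [add_sub_cancel_right, add_comm, mul_comm x]
      congr 1
      refine Finset.sum_congr rfl fun i _ => ?_
      ring
    · refine Finset.sum_induction _ (fun y : ℂ_[p] => ‖y‖ ≤ 1)
        (fun a b ha hb => (PadicComplex.isNonarchimedean p a b).trans (max_le ha hb)) (by simp) ?_
      intro i _
      rw [norm_mul, norm_pow]
      exact mul_le_one₀ (pow_le_one₀ (norm_nonneg _) hx1.le) (norm_nonneg _)
        (PadicComplex.norm_natCast_le_one p _)
  have hlt : ‖x ^ 2 * c‖ < ‖(p : ℂ_[p]) * x‖ := by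
    rw [norm_mul, norm_mul, norm_pow, PadicComplex.norm_p]
    calc ‖x‖ ^ 2 * ‖c‖ ≤ ‖x‖ ^ 2 := mul_le_of_le_one_right (by positivity) hc1
      _ = ‖x‖ * ‖x‖ := sq _
      _ < (p : ℝ)⁻¹ * ‖x‖ := by gcongr
  rw [hc, add_comm, IsUltrametricDist.norm_add_eq_max_of_norm_ne_norm hlt.ne,
    max_eq_right hlt.le, norm_mul, PadicComplex.norm_p]

/-- The logarithm series is isometric near `0`, hence has no other zero there. -/
theorem norm_padicLogSeries (p : ℕ) [Fact p.Prime] {x : ℂ_[p]} (hx : ‖x‖ < (p : ℝ)⁻¹) :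
    ‖padicLogSeries p x‖ = ‖x‖ := by
  have hp := (Fact.out : p.Prime)
  have hp1 : (p : ℝ)⁻¹ < 1 := inv_lt_one_of_one_lt₀ (by exact_mod_cast hp.one_lt)
  have hp0 : (p : ℝ) ≠ 0 := by exact_mod_cast hp.ne_zero
  have key : ∀ n : ℕ, ‖(1 + x) ^ (p ^ n) - 1‖ = ((p : ℝ)⁻¹) ^ n * ‖x‖ := by
    intro n
    induction n with
    | zero => simp
    | succ n ih =>
      have h := norm_one_add_pow_prime_sub_one p (x := (1 + x) ^ (p ^ n) - 1) (by
        rw [ih]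
        exact (mul_le_of_le_one_left (norm_nonneg _)
          (pow_le_one₀ (by positivity) hp1.le)).trans_lt hx)
      rw [add_sub_cancel, ← pow_mul, ← pow_succ, ih] at h
      rw [h]; ring
  refine tendsto_nhds_unique (tendsto_padicLogSeries p (hx.trans hp1)).norm ?_
  refine tendsto_const_nhds.congr fun n => ?_
  rw [norm_div, key, norm_pow, PadicComplex.norm_p]
  field_simp

/-- The kernel of the logarithm series on the open unit ball around `1` consists of roots of unity:
high `p`-power powers move any element into the ball where the series is isometric. -/
theorem exists_pow_eq_one_of_padicLogSeries_eq_zero (p : ℕ) [Fact p.Prime] {u : ℂ_[p]}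
    (hu : ‖u - 1‖ < 1) (h : padicLogSeries p (u - 1) = 0) : ∃ n : ℕ, 0 < n ∧ u ^ n = 1 := by
  have hp := (Fact.out : p.Prime)
  have hp0 : (p : ℂ_[p]) ≠ 0 := by exact_mod_cast hp.ne_zero
  have ht := (tendsto_prime_pow_zero p).mul (tendsto_padicLogSeries p hu)
  rw [h, mul_zero] at ht
  have ht' : Tendsto (fun n : ℕ => ‖u ^ (p ^ n) - 1‖) atTop (𝓝 0) := by
    rw [← norm_zero (E := ℂ_[p])]
    refine ht.norm.congr fun n => ?_
    rw [mul_div_cancel₀ _ (pow_ne_zero _ hp0), add_sub_cancel]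
  obtain ⟨n, hn⟩ := (ht'.eventually_lt_const
    (show (0 : ℝ) < (p : ℝ)⁻¹ by have := hp.pos; positivity)).exists
  refine ⟨p ^ n, pow_pos hp.pos _, ?_⟩
  have h1 := norm_padicLogSeries p hn
  rw [padicLogSeries_pow p hu, h, mul_zero, norm_zero, eq_comm, norm_eq_zero, sub_eq_zero] at h1
  exact h1

theorem exists_pow_eq_one_of_iwasawaLog_eq_zero (p : ℕ) [Fact p.Prime] {z : ℂ_[p]}
    (hz : ‖z‖ = 1) (h : iwasawaLog p z = 0) : ∃ n : ℕ, 0 < n ∧ z ^ n = 1 := by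
  have hp := (Fact.out : p.Prime)
  have hz0 : z ≠ 0 := by rintro rfl; simp at hz
  obtain ⟨⟨k, m⟩, hk, hm⟩ := PadicComplex.exists_normalization p hz0
  dsimp only at hk hm
  have hk0 : (k : ℂ_[p]) ≠ 0 := by exact_mod_cast hk.ne'
  rw [iwasawaLog_eq p hk hm, div_eq_zero_iff, or_iff_left hk0] at h
  obtain ⟨n, hn, hpow⟩ := exists_pow_eq_one_of_padicLogSeries_eq_zero p hm h
  have hnorm := congrArg norm hpow
  rw [norm_pow, norm_mul, norm_pow, hz, one_pow, one_mul, norm_zpow, PadicComplex.norm_p, norm_one,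
    pow_eq_one_iff_of_nonneg (by positivity) hn.ne'] at hnorm
  have hp1 : (p : ℝ)⁻¹ ≠ 1 := by
    rw [ne_eq, inv_eq_one]; exact_mod_cast hp.one_lt.ne'
  have hm0 : m = 0 := (zpow_eq_one_iff_right₀ (by have := hp.pos; positivity) hp1).1 hnorm
  subst hm0
  refine ⟨k * n, Nat.mul_pos hk hn, ?_⟩
  rwa [zpow_zero, mul_one, ← pow_mul] at hpow

theorem iwasawaLog_one (p : ℕ) [Fact p.Prime] : iwasawaLog p 1 = 0 := by
  simpa using iwasawaLog_mul p one_ne_zero one_ne_zero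

theorem iwasawaLog_pow (p : ℕ) [Fact p.Prime] {z : ℂ_[p]} (hz : z ≠ 0) (n : ℕ) :
    iwasawaLog p (z ^ n) = n * iwasawaLog p z := by
  induction n with
  | zero => simp [iwasawaLog_one]
  | succ n ih =>
    rw [pow_succ, iwasawaLog_mul p (pow_ne_zero _ hz) hz, ih]
    push_cast; ring

/-- The set of logarithms of algebraic numbers is divisible, as algebraic numbers have roots. -/
theorem mem_logsOfAlgebraicNumbers_of_natCast_mul (p : ℕ) [Fact p.Prime] {n : ℕ} (hn : 0 < n)
    {l z : ℂ_[p]} (hz : z ≠ 0) (hza : IsAlgebraic ℚ z) (h : n * l = iwasawaLog p z) :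
    l ∈ logsOfAlgebraicNumbers p := by
  obtain ⟨y, hy⟩ := IsAlgClosed.exists_pow_nat_eq z hn
  have hy0 : y ≠ 0 := by rintro rfl; exact hz (by rw [← hy, zero_pow hn.ne'])
  have hn0 : (n : ℂ_[p]) ≠ 0 := by exact_mod_cast hn.ne'
  refine ⟨y, hy0, IsAlgebraic.of_pow hn (hy ▸ hza), mul_left_cancel₀ hn0 ?_⟩
  rw [h, ← hy, iwasawaLog_pow p hy0]

/-- Elements of `ℂ_[p]` that are integral over `ℤ` lie in the closed unit ball. -/
theorem PadicComplex.norm_le_one_of_isIntegral (p : ℕ) [Fact p.Prime] {z : ℂ_[p]}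
    (hz : IsIntegral ℤ z) : ‖z‖ ≤ 1 := by
  by_contra! h
  obtain ⟨f, hf, hfz⟩ := hz
  have hz0 : 0 < ‖z‖ := one_pos.trans h
  rw [← Polynomial.aeval_def, Polynomial.aeval_eq_sum_range, Finset.sum_range_succ,
    hf.coeff_natDegree, one_smul, add_comm, add_eq_zero_iff_eq_neg] at hfz
  have hlt : ‖∑ i ∈ Finset.range f.natDegree, f.coeff i • z ^ i‖ < ‖z‖ ^ f.natDegree := by
    refine Finset.sum_induction _ (fun y : ℂ_[p] => ‖y‖ < ‖z‖ ^ f.natDegree)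
      (fun a b ha hb => (PadicComplex.isNonarchimedean p a b).trans_lt (max_lt ha hb))
      (by simpa using pow_pos hz0 _) ?_
    intro i hi
    rw [zsmul_eq_mul, norm_mul, norm_pow]
    exact (mul_le_of_le_one_left (by positivity)
      (IsUltrametricDist.norm_intCast_le_one _ _)).trans_lt
        (pow_lt_pow_right₀ h (Finset.mem_range.1 hi))
  rw [← norm_pow, hfz, norm_neg] at hlt
  exact lt_irrefl _ hlt

end PadicLogarithmKernel

/-! ### Singular matrices from representations of finite groups -/

section RepresentationRank

open scoped TensorProduct

variable {k G U : Type*} [Field k] [Group G] [AddCommGroup U] [Module k U]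

/-- If `U` becomes, over an extension `K` of `k`, a subrepresentation of the regular representation
`G → K`, then the image of any `a` of the group algebra on `U` has at most the dimension of the
left ideal generated by `a`. Indeed `a` acts on `G → K` by the matrix `(a (h⁻¹ g))_{h, g}`, whose
rows are the elements `h * a` and so span a space of dimension at most that of the left ideal. -/
theorem finrank_range_asAlgebraHom_le [Finite G] {K : Type*} [Field K] [Algebra k K]
    [FiniteDimensional k U]
    (ρ : Representation k G U) (Λ : U →ₗ[k] (G → K))
    (hΛ : ∀ g u h, Λ (ρ g u) h = Λ u (h * g))
    (hinj : Function.Injective (Λ.liftBaseChange K)) (a : MonoidAlgebra k G) :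
    Module.finrank k (LinearMap.range (ρ.asAlgebraHom a)) ≤
      Module.finrank k ((Ideal.span {a}).restrictScalars k) := by
  cases nonempty_fintype G
  classical
  set I : Submodule k (MonoidAlgebra k G) := (Ideal.span {a}).restrictScalars k
  set E : Matrix G G K := Matrix.of fun h g => algebraMap k K (a.coeff (h⁻¹ * g))
  have hact : ∀ u, Λ (ρ.asAlgebraHom a u) = E.mulVec (Λ u) := by
    intro u
    ext h
    have : ∀ b : MonoidAlgebra k G, Λ (ρ.asAlgebraHom b u) h =
        ∑ g, algebraMap k K (b.coeff (h⁻¹ * g)) * Λ u g := by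
      intro b
      induction b using MonoidAlgebra.induction_linear with
      | zero => simp
      | add f g hf hg => simp [hf, hg, add_mul, Finset.sum_add_distrib]
      | single x r =>
        rw [Representation.asAlgebraHom_single, LinearMap.smul_apply, map_smul, Pi.smul_apply, hΛ,
          Finset.sum_eq_single (h * x)]
        · simp [Algebra.smul_def]
        · intro g _ hg
          rw [MonoidAlgebra.coeff_single, Finsupp.single_eq_of_ne, map_zero, zero_mul]
          rintro rfl
          simp at hg
        · simp
    rw [this]
    rfl
  -- the range embeds in the column space of `E`
  have h1 : Module.finrank k (LinearMap.range (ρ.asAlgebraHom a)) ≤ E.rank := by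
    set R := LinearMap.range (ρ.asAlgebraHom a)
    let b := Module.finBasis k R
    have hb : LinearIndependent k (fun i => (b i : U)) :=
      b.linearIndependent.map' R.subtype (Submodule.ker_subtype R)
    have hbK : LinearIndependent K (fun i => (1 : K) ⊗ₜ[k] (b i : U)) :=
      Module.Flat.linearIndependent_one_tmul hb
    have hΛb : LinearIndependent K (fun i => Λ (b i : U)) := by
      refine (funext fun i => ?_ : (fun i => Λ (b i : U)) =
        Λ.liftBaseChange K ∘ fun i => (1 : K) ⊗ₜ[k] (b i : U)) ▸
          hbK.map' _ (LinearMap.ker_eq_bot.2 hinj)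
      simp
    have hmem : ∀ i, Λ (b i : U) ∈ LinearMap.range E.mulVecLin := by
      intro i
      obtain ⟨u, hu⟩ := (b i).2
      exact ⟨Λ u, by rw [← hu, hact]; rfl⟩
    have := LinearIndependent.of_comp (v := fun i => (⟨_, hmem i⟩ : LinearMap.range E.mulVecLin))
      (LinearMap.range E.mulVecLin).subtype hΛb
    simpa [Matrix.rank] using this.fintype_card_le_finrank
  -- the rows of `E` lie in the `K`-span of a basis of the left ideal
  have h2 : E.rank ≤ Module.finrank k I := by
    rw [Matrix.rank_eq_finrank_span_row]
    let c := Module.finBasis k I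
    let J : MonoidAlgebra k G →ₗ[k] (G → K) :=
      { toFun := fun f g => algebraMap k K (f.coeff g)
        map_add' := fun f f' => by ext; simp
        map_smul' := fun r f => by ext; simp [Algebra.smul_def] }
    have hJ : ∀ f ∈ I, J f ∈ Submodule.span K (Set.range fun i => J (c i)) := by
      intro f hf
      have hf' := congrArg Subtype.val (c.sum_repr ⟨f, hf⟩)
      dsimp only at hf'
      rw [← hf', Submodule.coe_sum, map_sum]
      refine Submodule.sum_mem _ fun i _ => ?_
      rw [Submodule.coe_smul, map_smul, ← algebraMap_smul K]
      exact Submodule.smul_mem _ _ (Submodule.subset_span ⟨i, rfl⟩)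
    have hle : Submodule.span K (Set.range E.row) ≤
        Submodule.span K (Set.range fun i => J (c i)) := by
      rw [Submodule.span_le]
      rintro _ ⟨h, rfl⟩
      have : E.row h = J (MonoidAlgebra.single h 1 * a) := by
        ext g
        simp [E, J, MonoidAlgebra.coeff_single_mul_apply]
      rw [this]
      exact hJ _ (Ideal.mul_mem_left _ _ (Ideal.mem_span_singleton_self a))
    refine (Submodule.finrank_mono hle).trans ((finrank_range_le_card _).trans ?_)
    simp
  exact h1.trans h2

/-- If a minimal left ideal `I` is generated by an idempotent `e`, then acting on a nonzero vector
of `e U` is injective on `I`: the elements of `I` that kill the vector form a left ideal without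
`e`. -/
theorem eq_zero_or_eq_zero_of_asAlgebraHom_apply_eq_zero (ρ : Representation k G U)
    {I : Ideal (MonoidAlgebra k G)} (hI : IsAtom I) {e : MonoidAlgebra k G}
    (he : IsIdempotentElem e) (heI : e ∈ I) {a : MonoidAlgebra k G} (ha : a ∈ I) {u : U}
    (hu : u ∈ LinearMap.range (ρ.asAlgebraHom e)) (h : ρ.asAlgebraHom a u = 0) :
    a = 0 ∨ u = 0 := by
  obtain ⟨u, rfl⟩ := hu
  let ann : Ideal (MonoidAlgebra k G) :=
    { carrier := {b | ρ.asAlgebraHom b (ρ.asAlgebraHom e u) = 0}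
      add_mem' := fun {b c} hb hc => by
        simp only [Set.mem_ofPred_eq] at *
        simp [hb, hc]
      zero_mem' := by simp
      smul_mem' := fun c b hb => by
        simp only [Set.mem_ofPred_eq] at *
        rw [smul_eq_mul, map_mul, Module.End.mul_apply, hb, map_zero] }
  rcases hI.le_iff.1 (inf_le_left : I ⊓ ann ≤ I) with hann | hann
  · left
    have : a ∈ I ⊓ ann := ⟨ha, h⟩
    rwa [hann, Submodule.mem_bot] at this
  · right
    have : e ∈ I ⊓ ann := by rwa [hann]
    have h2 : ρ.asAlgebraHom e (ρ.asAlgebraHom e u) = 0 := this.2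
    rwa [← Module.End.mul_apply, ← map_mul, he.eq] at h2

/-- Suppose that a nonzero vector `x` of `K ⊗ U` and all its translates are killed by a linear form
`ℓ` on `U`. Then some square matrix of values of `ℓ` is singular, although the vectors of `U` at
which `ℓ` is evaluated form the matrix of a bilinear map without zero divisors.

The bilinear map is `(w, v) ↦ w • v` on `I × e U`, restricted to a subspace of the first factor of
the same dimension as `e U`, where `I` is a minimal left ideal of the group algebra, generated by
an idempotent `e` with `e x ≠ 0`. -/
theorem exists_singular_matrix_of_forall_baseChange_eq_zero {K : Type*} [Field K] [Algebra k K]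
    [Finite G] [NeZero (Nat.card G : k)] [FiniteDimensional k U]
    (ρ : Representation k G U) (ℓ : U →ₗ[k] K)
    (hdim : ∀ a : MonoidAlgebra k G, Module.finrank k (LinearMap.range (ρ.asAlgebraHom a)) ≤
      Module.finrank k ((Ideal.span {a}).restrictScalars k))
    {x : K ⊗[k] U} (hx0 : x ≠ 0)
    (hx : ∀ g, ℓ.liftBaseChange K ((ρ g).baseChange K x) = 0) :
    ∃ (m : ℕ) (B : Fin m → Fin m → U), (Matrix.of fun i j => ℓ (B i j)).det = 0 ∧
      ∀ w v : Fin m → k, ∑ i, ∑ j, (w i * v j) • B i j = 0 → w = 0 ∨ v = 0 := by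
  have hxA : ∀ a, ℓ.liftBaseChange K ((ρ.asAlgebraHom a).baseChange K x) = 0 := by
    intro a
    induction a using MonoidAlgebra.induction_linear with
    | zero => simp
    | add f g hf hg => simp [LinearMap.baseChange_add, hf, hg]
    | single g r =>
      rw [Representation.asAlgebraHom_single, LinearMap.baseChange_smul, LinearMap.smul_apply,
        ← algebraMap_smul K, map_smul, hx, smul_zero]
  let annX : Ideal (MonoidAlgebra k G) :=
    { carrier := {a | (ρ.asAlgebraHom a).baseChange K x = 0}
      add_mem' := fun {a b} ha hb => by
        simp only [Set.mem_ofPred_eq] at *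
        simp [LinearMap.baseChange_add, ha, hb]
      zero_mem' := by simp
      smul_mem' := fun c a ha => by
        simp only [Set.mem_ofPred_eq] at *
        rw [smul_eq_mul, map_mul, Module.End.mul_eq_comp, LinearMap.baseChange_comp,
          LinearMap.comp_apply, ha, map_zero] }
  obtain ⟨J, hJ⟩ := exists_isCompl annX
  have hJ0 : J ≠ ⊥ := by
    rintro rfl
    have h1 : (1 : MonoidAlgebra k G) ∈ annX := by
      rw [show annX = ⊤ by simpa using hJ.sup_eq_top]; trivial
    have h1' : (ρ.asAlgebraHom 1).baseChange K x = 0 := h1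
    rw [map_one, Module.End.one_eq_id, LinearMap.baseChange_id] at h1'
    exact hx0 h1'
  obtain ⟨I, hIJ, hI⟩ := (IsSemisimpleModule.eq_bot_or_exists_simple_le J).resolve_left hJ0
  rw [isSimpleModule_iff_isAtom] at hI
  obtain ⟨e, he, hIe⟩ := IsSemisimpleRing.ideal_eq_span_idempotent I
  have heI : e ∈ I := by rw [hIe]; exact Ideal.mem_span_singleton_self e
  have hex : (ρ.asAlgebraHom e).baseChange K x ≠ 0 := by
    intro h
    have h0 : e = 0 := by
      have : e ∈ annX ⊓ J := ⟨h, hIJ heI⟩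
      rwa [hJ.inf_eq_bot, Submodule.mem_bot] at this
    exact hI.1 (by rw [hIe, h0]; simp)
  set R := LinearMap.range (ρ.asAlgebraHom e)
  set m := Module.finrank k R
  let v := Module.finBasis k R
  let w : Fin m → MonoidAlgebra k G := fun i =>
    (Module.finBasis k (I.restrictScalars k) (Fin.castLE (by rw [hIe]; exact hdim e) i) : _)
  have hw : LinearIndependent k w := by
    have h1 := (Module.finBasis k (I.restrictScalars k)).linearIndependent.map'
      (I.restrictScalars k).subtype (Submodule.ker_subtype _)
    exact h1.comp _ (Fin.castLE_injective _)
  have hwI : ∀ i, w i ∈ I := fun i => Subtype.prop (Module.finBasis k (I.restrictScalars k) _)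
  refine ⟨m, fun i j => ρ.asAlgebraHom (w i) (v j), ?_, ?_⟩
  · -- the coordinates of `e x` in the basis of `e U` form a vector of the kernel
    obtain ⟨y, hy⟩ : ∃ y : K ⊗[k] R, R.subtype.baseChange K y =
        (ρ.asAlgebraHom e).baseChange K x := by
      refine ⟨(ρ.asAlgebraHom e).rangeRestrict.baseChange K x, ?_⟩
      rw [← LinearMap.comp_apply, ← LinearMap.baseChange_comp, LinearMap.subtype_comp_codRestrict]
    let vK := v.baseChange K
    rw [← Matrix.exists_mulVec_eq_zero_iff]
    refine ⟨fun j => vK.repr y j, ?_, ?_⟩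
    · intro h0
      have : y = 0 := by
        apply vK.repr.injective
        ext j
        simpa using congrFun h0 j
      rw [this, map_zero] at hy
      exact hex hy.symm
    · ext i
      have h1 := hxA (w i * e)
      rw [map_mul, Module.End.mul_eq_comp, LinearMap.baseChange_comp, LinearMap.comp_apply, ← hy,
        ← vK.sum_repr y] at h1
      simp only [map_sum] at h1
      rw [Pi.zero_apply, ← h1, Matrix.mulVec, dotProduct]
      refine Finset.sum_congr rfl fun j _ => ?_
      rw [map_smul, map_smul, map_smul, Module.Basis.baseChange_apply, LinearMap.baseChange_tmul,
        LinearMap.baseChange_tmul, LinearMap.liftBaseChange_tmul, one_smul, smul_eq_mul, mul_comm]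
      rfl
  · intro c d hcd
    have h1 : ρ.asAlgebraHom (∑ i, c i • w i) (∑ j, d j • (v j : U)) = 0 := by
      rw [← hcd, map_sum (ρ.asAlgebraHom), LinearMap.sum_apply]
      refine Finset.sum_congr rfl fun i _ => ?_
      rw [map_sum]
      refine Finset.sum_congr rfl fun j _ => ?_
      rw [map_smul, map_smul, LinearMap.smul_apply, smul_smul, mul_comm]
    have hmemI : ∑ i, c i • w i ∈ I :=
      Submodule.sum_mem (I.restrictScalars k) fun i _ => Submodule.smul_mem _ _ (hwI i)
    have hmemR : ∑ j, d j • (v j : U) ∈ R :=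
      Submodule.sum_mem _ fun j _ => Submodule.smul_mem _ _ (v j).2
    refine (eq_zero_or_eq_zero_of_asAlgebraHom_apply_eq_zero ρ hI he heI hmemI hmemR h1).imp
      (fun h => ?_) fun h => ?_
    · exact funext (Fintype.linearIndependent_iff.1 hw c h)
    · have hv : LinearIndependent k fun j => (v j : U) :=
        v.linearIndependent.map' R.subtype (Submodule.ker_subtype _)
      exact funext (Fintype.linearIndependent_iff.1 hv d h)

end RepresentationRank

/-! ### The Galois representation on units and Dirichlet's theorem -/

section UnitRepresentation

open scoped TensorProduct NumberField
open NumberField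

/-- For a normal extension of `ℚ`, any two embeddings into a field differ by an automorphism. -/
theorem exists_comp_eq_of_normal {E L : Type*} [Field E] [CharZero E] [Normal ℚ E]
    [Field L] [CharZero L] (φ ψ : E →+* L) : ∃ σ : E ≃ₐ[ℚ] E, ∀ x, ψ x = φ (σ x) := by
  let := φ.toAlgebra
  have : IsScalarTower ℚ E L := IsScalarTower.of_algebraMap_eq' (Subsingleton.elim _ _)
  exact ⟨AlgHom.restrictNormal' ψ.toRatAlgHom E, fun x =>
    (AlgHom.restrictNormal_commutes ψ.toRatAlgHom E x).symm⟩

namespace NumberField.Units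

variable {E F : Type*} [Field E] [Field F]

/-- The map induced by a field embedding on the units of the rings of integers, tensored with `ℚ`.
-/
noncomputable def mapRat (f : E →+* F) :
    ℚ ⊗[ℤ] Additive (𝓞 E)ˣ →ₗ[ℚ] ℚ ⊗[ℤ] Additive (𝓞 F)ˣ :=
  (MonoidHom.toAdditive
    (Units.map (RingOfIntegers.mapRingHom f : 𝓞 E →* 𝓞 F))).toIntLinearMap.baseChange ℚ

theorem linearMap_ext {M : Type*} [AddCommGroup M] [Module ℚ M]
    {f g : ℚ ⊗[ℤ] Additive (𝓞 E)ˣ →ₗ[ℚ] M}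
    (h : ∀ u : (𝓞 E)ˣ, f (1 ⊗ₜ Additive.ofMul u) = g (1 ⊗ₜ Additive.ofMul u)) : f = g := by
  ext u
  exact h u.toMul

/-- The action of the automorphisms of a field on the units of its ring of integers, tensored with
`ℚ`. -/
noncomputable def galRep (E : Type*) [Field E] [CharZero E] :
    Representation ℚ (E ≃ₐ[ℚ] E) (ℚ ⊗[ℤ] Additive (𝓞 E)ˣ) where
  toFun σ := mapRat (σ : E →+* E)
  map_one' := linearMap_ext fun _ => rfl
  map_mul' _ _ := linearMap_ext fun _ => rfl

/-- Every element of `𝓞ˣ ⊗ ℚ` has a positive multiple that comes from a unit. -/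
theorem exists_nsmul_eq_one_tmul (x : ℚ ⊗[ℤ] Additive (𝓞 E)ˣ) :
    ∃ n : ℕ, 0 < n ∧ ∃ u : (𝓞 E)ˣ, n • x = 1 ⊗ₜ Additive.ofMul u := by
  induction x with
  | zero => exact ⟨1, one_pos, 1, by simp⟩
  | tmul q a =>
    refine ⟨q.den, q.den_pos, (q.num • a).toMul, ?_⟩
    rw [ofMul_toMul, ← TensorProduct.smul_tmul (q.num : ℤ) (1 : ℚ) a, TensorProduct.smul_tmul',
      nsmul_eq_mul, mul_comm, Rat.mul_den_eq_num, zsmul_eq_mul, mul_one]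
  | add x y hx hy =>
    obtain ⟨m, hm, u, hu⟩ := hx
    obtain ⟨n, hn, v, hv⟩ := hy
    refine ⟨m * n, Nat.mul_pos hm hn, u ^ n * v ^ m, ?_⟩
    rw [ofMul_mul, TensorProduct.tmul_add, ofMul_pow, ofMul_pow, TensorProduct.tmul_smul,
      TensorProduct.tmul_smul, ← hu, ← hv, smul_add, smul_smul, smul_smul, mul_comm n m]

theorem one_tmul_eq_zero_of_pow_eq_one {u : (𝓞 E)ˣ} {n : ℕ} (hn : 0 < n) (hu : u ^ n = 1) :
    (1 : ℚ) ⊗ₜ[ℤ] Additive.ofMul u = 0 := by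
  have h : n • ((1 : ℚ) ⊗ₜ[ℤ] Additive.ofMul u) = 0 := by
    rw [← TensorProduct.tmul_smul, ← ofMul_pow, hu, ofMul_one, TensorProduct.tmul_zero]
  rw [← Nat.cast_smul_eq_nsmul ℚ] at h
  exact (smul_eq_zero.1 h).resolve_left (by exact_mod_cast hn.ne')

theorem mapRat_injective (f : E →+* F) : Function.Injective (mapRat f) := by
  refine Module.Flat.lTensor_preserves_injective_linearMap _ fun u v huv => ?_
  have h : (Units.map (RingOfIntegers.mapRingHom f : 𝓞 E →* 𝓞 F)) u.toMul =
      (Units.map (RingOfIntegers.mapRingHom f : 𝓞 E →* 𝓞 F)) v.toMul := huv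
  have h' := congrArg (fun w : (𝓞 F)ˣ => ((w : 𝓞 F) : F)) h
  exact Units.ext (RingOfIntegers.ext (f.injective h'))

theorem finrank_rat_tensorProduct (E : Type*) [Field E] [NumberField E] :
    Module.finrank ℚ (ℚ ⊗[ℤ] Additive (𝓞 E)ˣ) = rank E := by
  rw [(TensorProduct.isBaseChange ℤ (Additive (𝓞 E)ˣ) ℚ).finrank_eq, finrank_eq]

variable [NumberField E]

/-- Dirichlet's unit theorem: the logarithmic embedding is injective on `𝓞ˣ ⊗ ℝ`. It is surjective
because the unit lattice spans the logarithmic space, and the dimensions agree. -/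
theorem injective_liftBaseChange_logEmbedding :
    Function.Injective
      (((logEmbedding E).toIntLinearMap.liftBaseChange ℚ).liftBaseChange ℝ) := by
  rw [LinearMap.injective_iff_surjective_of_finrank_eq_finrank]
  · rw [← LinearMap.range_eq_top, eq_top_iff, ← dirichletUnitTheorem.unitLattice_span_eq_top,
      Submodule.span_le]
    rintro _ ⟨u, -, rfl⟩
    exact ⟨1 ⊗ₜ (1 ⊗ₜ u), by simp⟩
  · rw [Module.finrank_baseChange, finrank_rat_tensorProduct, Units.finrank_eq_rank]

/-- The conjugates of the logarithmic absolute value of a unit at a complex embedding. -/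
noncomputable def galLog (φ : E →+* ℂ) :
    ℚ ⊗[ℤ] Additive (𝓞 E)ˣ →ₗ[ℚ] ((E ≃ₐ[ℚ] E) → ℝ) :=
  AddMonoidHom.toIntLinearMap (
    { toFun := fun u σ => Real.log ‖φ (σ ((u.toMul : 𝓞 E) : E))‖
      map_zero' := by ext; simp
      map_add' := fun u v => by
        ext σ
        simp [Real.log_mul] } : Additive (𝓞 E)ˣ →+ ((E ≃ₐ[ℚ] E) → ℝ)) |>.liftBaseChange ℚ

theorem galLog_one_tmul (φ : E →+* ℂ) (u : (𝓞 E)ˣ) (σ : E ≃ₐ[ℚ] E) :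
    galLog φ (1 ⊗ₜ Additive.ofMul u) σ = Real.log ‖φ (σ ((u : 𝓞 E) : E))‖ := by
  simp [galLog]

theorem galLog_galRep (φ : E →+* ℂ) (g : E ≃ₐ[ℚ] E) (u : ℚ ⊗[ℤ] Additive (𝓞 E)ˣ)
    (h : E ≃ₐ[ℚ] E) : galLog φ (galRep E g u) h = galLog φ u (h * g) := by
  suffices H : LinearMap.proj h ∘ₗ galLog φ ∘ₗ galRep E g = LinearMap.proj (h * g) ∘ₗ galLog φ from
    LinearMap.congr_fun H u
  refine linearMap_ext fun u => ?_
  exact (galLog_one_tmul φ _ h).trans (galLog_one_tmul φ u (h * g)).symm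

/-- As the Galois group permutes the infinite places transitively, the conjugates of one logarithmic
absolute value determine the whole logarithmic embedding. -/
theorem injective_liftBaseChange_galLog [Normal ℚ E] (φ : E →+* ℂ) :
    Function.Injective ((galLog φ).liftBaseChange ℝ) := by
  choose σ hσ using fun w : InfinitePlace E => exists_comp_eq_of_normal φ w.embedding
  let π : ((E ≃ₐ[ℚ] E) → ℝ) →ₗ[ℝ] dirichletUnitTheorem.logSpace E :=
    LinearMap.pi fun w => (w.1.mult : ℝ) • LinearMap.proj (σ w.1)
  suffices H : π ∘ₗ (galLog φ).liftBaseChange ℝ =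
      ((logEmbedding E).toIntLinearMap.liftBaseChange ℚ).liftBaseChange ℝ by
    have := injective_liftBaseChange_logEmbedding (E := E)
    rw [← H, LinearMap.coe_comp] at this
    exact this.of_comp
  have hQ : π.restrictScalars ℚ ∘ₗ galLog φ =
      (logEmbedding E).toIntLinearMap.liftBaseChange ℚ := by
    refine linearMap_ext fun u => ?_
    ext w
    simp [π, galLog_one_tmul, ← hσ, logEmbedding, InfinitePlace.norm_embedding_eq]
  refine TensorProduct.AlgebraTensorModule.curry_injective
    (LinearMap.ext_ring (LinearMap.ext fun x => ?_))
  simpa using LinearMap.congr_fun hQ x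

end NumberField.Units

end UnitRepresentation

/-! ### The `p`-adic regulator -/

section PadicRegulator

open scoped TensorProduct NumberField
open NumberField NumberField.Units

variable {p : ℕ} [Fact p.Prime]

/-- The `p`-adic logarithm at an embedding into `ℂ_[p]`, as a linear form on `𝓞ˣ ⊗ ℚ`. -/
noncomputable def unitLog {E : Type*} [Field E] (τ : E →+* ℂ_[p]) :
    ℚ ⊗[ℤ] Additive (𝓞 E)ˣ →ₗ[ℚ] ℂ_[p] :=
  LinearMap.proj τ ∘ₗ (unitLogHom p E).toIntLinearMap.liftBaseChange ℚ

theorem unitLog_one_tmul {E : Type*} [Field E] (τ : E →+* ℂ_[p]) (u : (𝓞 E)ˣ) :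
    unitLog τ (1 ⊗ₜ Additive.ofMul u) = iwasawaLog p (τ ((u : 𝓞 E) : E)) := by
  simp [unitLog, unitLogHom]

theorem padicRegulatorMap_apply {E : Type*} [Field E] (τ : E →+* ℂ_[p])
    (x : ℂ_[p] ⊗[ℚ] (ℚ ⊗[ℤ] Additive (𝓞 E)ˣ)) :
    padicRegulatorMap p E x τ = (unitLog τ).liftBaseChange ℂ_[p] x := by
  induction x with
  | zero => simp
  | tmul c u => simp [padicRegulatorMap, unitLog]
  | add x y hx hy => rw [map_add, map_add, Pi.add_apply, hx, hy]

theorem unitLog_mapRat {E F : Type*} [Field E] [Field F] (f : E →+* F) (τ : F →+* ℂ_[p])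
    (u : ℚ ⊗[ℤ] Additive (𝓞 E)ˣ) : unitLog τ (mapRat f u) = unitLog (τ.comp f) u := by
  suffices H : unitLog τ ∘ₗ mapRat f = unitLog (τ.comp f) from LinearMap.congr_fun H u
  refine linearMap_ext fun u => ?_
  exact (unitLog_one_tmul τ _).trans (unitLog_one_tmul (τ.comp f) u).symm

theorem liftBaseChange_unitLog_mapRat {E F : Type*} [Field E] [Field F] (f : E →+* F)
    (τ : F →+* ℂ_[p]) (x : ℂ_[p] ⊗[ℚ] (ℚ ⊗[ℤ] Additive (𝓞 E)ˣ)) :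
    (unitLog τ).liftBaseChange ℂ_[p] ((mapRat f).baseChange ℂ_[p] x) =
      (unitLog (τ.comp f)).liftBaseChange ℂ_[p] x := by
  induction x with
  | zero => simp
  | tmul c u => simp [unitLog_mapRat]
  | add x y hx hy => rw [map_add, map_add, map_add, hx, hy]

theorem isIntegral_embedding {E : Type*} [Field E] (τ : E →+* ℂ_[p]) (x : 𝓞 E) :
    IsIntegral ℤ (τ (x : E)) := by
  obtain ⟨f, hf, h⟩ := RingOfIntegers.isIntegral_coe x
  refine ⟨f, hf, ?_⟩
  rw [RingHom.ext_int (algebraMap ℤ ℂ_[p]) (τ.comp (algebraMap ℤ E)), ← Polynomial.hom_eval₂, h,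
    map_zero]

/-- A unit with vanishing `p`-adic logarithm is a root of unity: it has absolute value `1`, so no
power of `p` can intervene. -/
theorem unitLog_injective {E : Type*} [Field E] (τ : E →+* ℂ_[p]) :
    Function.Injective (unitLog τ) := by
  rw [← LinearMap.ker_eq_bot, LinearMap.ker_eq_bot']
  intro x hx
  obtain ⟨n, hn, u, hu⟩ := exists_nsmul_eq_one_tmul x
  have hlog : iwasawaLog p (τ ((u : 𝓞 E) : E)) = 0 := by
    rw [← unitLog_one_tmul, ← hu, map_nsmul, hx, smul_zero]
  have hle : ∀ v : (𝓞 E)ˣ, ‖τ ((v : 𝓞 E) : E)‖ ≤ 1 := fun v =>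
    PadicComplex.norm_le_one_of_isIntegral p (isIntegral_embedding τ v)
  have hmul : τ ((u : 𝓞 E) : E) * τ (((u⁻¹ : (𝓞 E)ˣ) : 𝓞 E) : E) = 1 := by
    rw [← map_mul, ← map_mul, Units.mul_inv, map_one, map_one]
  have hnorm : ‖τ ((u : 𝓞 E) : E)‖ = 1 := by
    refine le_antisymm (hle u) ?_
    have h := congrArg norm hmul
    rw [norm_mul, norm_one] at h
    rw [← h]
    exact mul_le_of_le_one_right (norm_nonneg _) (hle _)
  obtain ⟨k, hk, hpow⟩ := exists_pow_eq_one_of_iwasawaLog_eq_zero p hnorm hlog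
  have huk : u ^ k = 1 := by
    refine Units.ext (RingOfIntegers.ext (τ.injective ?_))
    simpa using hpow
  rw [one_tmul_eq_zero_of_pow_eq_one hk huk, ← Nat.cast_smul_eq_nsmul ℚ] at hu
  exact (smul_eq_zero.1 hu).resolve_left (by exact_mod_cast hn.ne')

theorem unitLog_mem_logsOfAlgebraicNumbers {E : Type*} [Field E] (τ : E →+* ℂ_[p])
    (x : ℚ ⊗[ℤ] Additive (𝓞 E)ˣ) : unitLog τ x ∈ logsOfAlgebraicNumbers p := by
  obtain ⟨n, hn, u, hu⟩ := exists_nsmul_eq_one_tmul x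
  refine mem_logsOfAlgebraicNumbers_of_natCast_mul p hn (z := τ ((u : 𝓞 E) : E)) (by simp) ?_ ?_
  · obtain ⟨f, hf, h⟩ := isIntegral_embedding τ (u : 𝓞 E)
    refine IsIntegral.isAlgebraic ⟨f.map (algebraMap ℤ ℚ), hf.map _, ?_⟩
    rwa [Polynomial.eval₂_map, RingHom.ext_int ((algebraMap ℚ ℂ_[p]).comp (algebraMap ℤ ℚ))
      (algebraMap ℤ ℂ_[p])]
  · rw [← unitLog_one_tmul, ← hu, map_nsmul, nsmul_eq_mul]

/-- The conjecture applied to the singular matrix of logarithms of units produced by a nonzero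
vector in the kernel of the regulator contradicts the injectivity of the logarithm on `𝓞ˣ ⊗ ℚ`. -/
theorem padicRegulatorMap_injective_of_normal (h : PadicMatrixCoefficientConjecture p)
    (E : Type*) [Field E] [NumberField E] [Normal ℚ E] :
    Function.Injective (padicRegulatorMap p E) := by
  rw [← LinearMap.ker_eq_bot, LinearMap.ker_eq_bot']
  intro x hx
  by_contra hx0
  obtain ⟨φ⟩ : Nonempty (E →+* ℂ) := inferInstance
  obtain ⟨τ⟩ : Nonempty (E →+* ℂ_[p]) := ⟨(IsAlgClosed.lift : E →ₐ[ℚ] ℂ_[p]).toRingHom⟩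
  have hxτ : ∀ g, (unitLog τ).liftBaseChange ℂ_[p] ((galRep E g).baseChange ℂ_[p] x) = 0 := by
    intro g
    have := liftBaseChange_unitLog_mapRat (g : E →+* E) τ x
    rw [← padicRegulatorMap_apply (τ.comp (g : E →+* E)), hx] at this
    exact this
  obtain ⟨m, B, hdet, hB⟩ := exists_singular_matrix_of_forall_baseChange_eq_zero (galRep E)
    (unitLog τ) (finrank_range_asAlgebraHom_le (galRep E) (galLog φ) (galLog_galRep φ)
      (injective_liftBaseChange_galLog φ)) hx0 hxτ
  obtain ⟨w, v, hw, hv, hwv⟩ := h m _ (fun i j => unitLog_mem_logsOfAlgebraicNumbers τ (B i j)) hdet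
  refine (hB w v (unitLog_injective τ ?_)).elim hw hv
  rw [map_zero, ← hwv]
  simp only [map_sum, dotProduct, Matrix.mulVec, Finset.mul_sum]
  refine Finset.sum_congr rfl fun i _ => Finset.sum_congr rfl fun j _ => ?_
  rw [(unitLog τ).map_smul, Algebra.smul_def, eq_ratCast]
  push_cast
  ring

/-- Injectivity of the `p`-adic regulator descends to subfields, since embeddings of the larger
field restrict to the smaller one. -/
theorem padicRegulatorMap_injective_of_ringHom {F E : Type*} [Field F] [Field E] (f : F →+* E)
    (hE : Function.Injective (padicRegulatorMap p E)) :
    Function.Injective (padicRegulatorMap p F) := by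
  rw [← LinearMap.ker_eq_bot, LinearMap.ker_eq_bot']
  intro x hx
  have hf : Function.Injective ((mapRat f).baseChange ℂ_[p]) :=
    Module.Flat.lTensor_preserves_injective_linearMap _ (mapRat_injective f)
  refine hf (hE ?_)
  rw [map_zero, map_zero]
  ext τ
  rw [padicRegulatorMap_apply, liftBaseChange_unitLog_mapRat, ← padicRegulatorMap_apply, hx]
  rfl

end PadicRegulator

theorem theorem3 (p : ℕ) [Fact p.Prime] (h : PadicMatrixCoefficientConjecture p)
    (F : Type*) [Field F] [NumberField F] : LeopoldtConjecture p F := by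
  let E := IntermediateField.normalClosure ℚ F (AlgebraicClosure F)
  have : NumberField E := ⟨⟩
  have : Normal ℚ (AlgebraicClosure F) :=
    have := IsAlgClosure.ofAlgebraic ℚ F (AlgebraicClosure F)
    IsAlgClosure.normal ℚ _
  have : Normal ℚ E := normalClosure.normal ℚ F (AlgebraicClosure F)
  have hinj : Function.Injective (padicRegulatorMap p F) :=
    padicRegulatorMap_injective_of_ringHom (algebraMap F E)
      (padicRegulatorMap_injective_of_normal h E)
  rw [LeopoldtConjecture, LinearMap.finrank_range_of_inj hinj, Module.finrank_baseChange,
    NumberField.Units.finrank_rat_tensorProduct]
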